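/- Let $d\in\{1,2,3\}$, let $\Omega\subset\mathbb R^d$ be open and bounded, and let $\mathcal U=H^1_0(\Omega)$ be the closure of $C_c^\infty(\Omega)$ in $H^1(\Omega)$, with the norm $\|u\|_{\mathcal U}^2=\|u\|_{L^2(\Omega)}^2+\|\nabla u\|_{L^2(\Omega)}^2$ and the dual space $\mathcal U^*$. (1) There are constants $C_P,C_S>0$ depending only on $\Omega$ such that, for all $u\in\mathcal U$, $$\|u\|_{L^2(\Omega)}\le C_P\|\nabla u\|_{L^2(\Omega)},\qquad \|u\|_{L^4(\Omega)}\le C_S\|u\|_{\mathcal U}.\tag{$*$}$$ (2) Let $C_P,C_S>0$ be any constants satisfying $(*)$. Let $\kappa_0,\alpha,m_{\mathrm{lw}}>0$, let $f\in L^2(\Omega)$, and let $m\in L^2(\Omega)\cap L^\infty(\Omega)$ with $m\ge m_{\mathrm{lw}}$ almost everywhere. Then the formula $$\langle v,\mathcal R(m,u)\rangle=\int_\Omega\left\{\kappa_0\,m\,\nabla u\cdot\nabla v+\alpha u^3v\right\}dx-\int_\Omega fv\,dx,\qquad u,v\in\mathcal U,$$ has convergent integrals and defines a map $\mathcal R(m,\cdot):\mathcal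 U\to\mathcal U^*$, the residual of the problem $-\nabla\cdot(\kappa_0m\nabla u)+\alpha u^3=f$ in $\Omega$, $u=0$ on $\partial\Omega$. At every $\tilde u\in\mathcal U$ the Gâteaux derivative $\delta_u\mathcal R(m,\tilde u)(p)=\lim_{\epsilon\to0}\frac1\epsilon\left[\mathcal R(m,\tilde u+\epsilon p)-\mathcal R(m,\tilde u)\right]$ exists for all $p\in\mathcal U$ and is, as a function of $p$, a bounded linear bijection $\mathcal U\to\mathcal U^*$ with bounded inverse, so that the corrector operator $$\mathcal F^C(m,\tilde u)=\tilde u-\delta_u\mathcal R(m,\tilde u)^{-1}\mathcal R(m,\tilde u)$$ is well defined. Put $$\hat C_{\delta R}=\frac{\kappa_0m_{\mathrm{lw}}}{2}\min\{1,C_P^{-2}\},\qquad C=\frac{3\,\alpha\,C_S^4}{\hat C_{\delta R}}>0 .$$ Then for every $u\in\mathcal U$ with $\mathcal R(m,u)=0$ and every $\tilde u\in\mathcal U$ (for instance a neural-operator prediction of $u$), the errors $\tilde e=u-\tilde u$ and $e^C=u-\mathcal F^C(m,\tilde u)$ satisfy $$\|e^C\|_{\mathcal U}\le C\,\|\tilde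 u\|_{\mathcal U}\,\|\tilde e\|_{\mathcal U}^2+C\,\|\tilde e\|_{\mathcal U}^3 .$$ -/

import Mathlib

open MeasureTheory Topology
open scoped ENNReal ContDiff InnerProductSpace

noncomputable section

namespace NonlinearDiffusion

/-- `ℝᵈ` with the Euclidean norm. -/
abbrev Space (d : ℕ) : Type := EuclideanSpace ℝ (Fin d)

/-- Lebesgue measure on `Ω`. -/
abbrev vol {d : ℕ} (Ω : Set (Space d)) : Measure (Space d) := volume.restrict Ω

/-- The Hilbert space `L²(Ω) × L²(Ω; ℝᵈ)` with `‖(u, g)‖² = ‖u‖² + ‖g‖²`. A Sobolev function `u`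
is represented by the pair `(u, ∇u)`, so that the norm of the pair is the `H¹` norm of `u`. -/
abbrev L2Pairs {d : ℕ} (Ω : Set (Space d)) : Type :=
  WithLp 2 (Lp ℝ 2 (vol Ω) × Lp (Space d) 2 (vol Ω))

/-- The pairs `(φ, ∇φ)` with `φ ∈ C_c^∞(Ω)`. -/
def testPairs {d : ℕ} (Ω : Set (Space d)) : Set (L2Pairs Ω) :=
  {w | ∃ φ : Space d → ℝ, ContDiff ℝ ∞ φ ∧ HasCompactSupport φ ∧ tsupport φ ⊆ Ω ∧
    w.fst =ᵐ[vol Ω] φ ∧ w.snd =ᵐ[vol Ω] gradient φ}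

/-- The Sobolev space `H¹₀(Ω)`: the closure of `C_c^∞(Ω)` in the `H¹` norm. The set `testPairs Ω`
is already a linear subspace, so the span adds nothing. Limits of the pairs `(φ, ∇φ)` in `L²` are
pairs `(u, ∇u)` with `∇u` the weak gradient of `u`. -/
def H10 {d : ℕ} (Ω : Set (Space d)) : Submodule ℝ (L2Pairs Ω) :=
  (Submodule.span ℝ (testPairs Ω)).topologicalClosure

/-- The function `u ∈ L²(Ω)` underlying an element of `H¹₀(Ω)`. -/
def toFun {d : ℕ} {Ω : Set (Space d)} (u : H10 Ω) : Lp ℝ 2 (vol Ω) := (u : L2Pairs Ω).fst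

/-- The weak gradient `∇u ∈ L²(Ω; ℝᵈ)` of an element of `H¹₀(Ω)`. -/
def grad {d : ℕ} {Ω : Set (Space d)} (u : H10 Ω) : Lp (Space d) 2 (vol Ω) := (u : L2Pairs Ω).snd

/-- `C_P` is a constant in the Poincaré inequality `‖u‖_{L²} ≤ C_P ‖∇u‖_{L²}` on `H¹₀(Ω)`. -/
def IsPoincareConst {d : ℕ} (Ω : Set (Space d)) (C_P : ℝ) : Prop :=
  0 < C_P ∧ ∀ u : H10 Ω, ‖toFun u‖ ≤ C_P * ‖grad u‖

/-- `C_S` is a constant in the Sobolev embedding `‖u‖_{L⁴} ≤ C_S ‖u‖_{H¹}` on `H¹₀(Ω)`. -/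
def IsSobolevConst {d : ℕ} (Ω : Set (Space d)) (C_S : ℝ) : Prop :=
  0 < C_S ∧ ∀ u : H10 Ω, eLpNorm (toFun u) 4 (vol Ω) ≤ ENNReal.ofReal (C_S * ‖u‖)

/-- The admissible diffusivities: `m ∈ L²(Ω) ∩ L^∞(Ω)` with `m ≥ m_lw` almost everywhere. -/
def Diffusivities {d : ℕ} (Ω : Set (Space d)) (m_lw : ℝ) : Set (Space d → ℝ) :=
  {m | MemLp m 2 (vol Ω) ∧ MemLp m ∞ (vol Ω) ∧ ∀ᵐ x ∂(vol Ω), m_lw ≤ m x}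

/-- The integrand `κ₀ m ∇u · ∇v + α u³ v` of the semilinear form `b(m, u; v)`. -/
def formIntegrand {d : ℕ} {Ω : Set (Space d)} (κ₀ α : ℝ) (m : Space d → ℝ) (u v : H10 Ω)
    (x : Space d) : ℝ :=
  κ₀ * m x * ⟪grad u x, grad v x⟫_ℝ + α * (toFun u x) ^ 3 * toFun v x

/-- The functional `ℓ ∈ H¹₀(Ω)*` is given by
`ℓ(v) = ∫_Ω (κ₀ m ∇u · ∇v + α u³ v) dx - ∫_Ω f v dx`, all integrals being convergent. -/
def IsResidual {d : ℕ} {Ω : Set (Space d)} (κ₀ α : ℝ) (f m : Space d → ℝ) (u : H10 Ω)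
    (ℓ : StrongDual ℝ (H10 Ω)) : Prop :=
  ∀ v : H10 Ω, Integrable (formIntegrand κ₀ α m u v) (vol Ω) ∧
    Integrable (fun x => f x * toFun v x) (vol Ω) ∧
    ℓ v = (∫ x, formIntegrand κ₀ α m u v x ∂(vol Ω)) - ∫ x, f x * toFun v x ∂(vol Ω)

open Classical in
/-- The residual `R(m, u) ∈ H¹₀(Ω)*`: the unique continuous functional with
`⟨v, R(m, u)⟩ = b(m, u; v) - ∫_Ω f v dx` for all `v` (and `0` if there were none). -/
def residualOp {d : ℕ} {Ω : Set (Space d)} (κ₀ α : ℝ) (f m : Space d → ℝ) (u : H10 Ω) :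
    StrongDual ℝ (H10 Ω) :=
  if h : ∃ ℓ : StrongDual ℝ (H10 Ω), IsResidual κ₀ α f m u ℓ then h.choose else 0

/-- The corrector operator `ũ ↦ ũ - δR(ũ)⁻¹ R(ũ)` of a map `R : U → U*`, where
`δR(ũ) : U → U*`, `p ↦ lim_{ε → 0} (R(ũ + ε p) - R(ũ)) / ε`, is the Gateaux derivative. -/
def corrector {U : Type*} [NormedAddCommGroup U] [NormedSpace ℝ U] (R : U → StrongDual ℝ U)
    (ũ : U) : U :=
  ũ - Function.invFun (fun p : U => lineDeriv ℝ R ũ p) (R ũ)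

/-- The lower bound `Ĉ = (κ₀ m_lw / 2) min {1, C_P⁻²}` for the derivative of the residual. -/
def coercivityConst (κ₀ m_lw C_P : ℝ) : ℝ := κ₀ * m_lw / 2 * min 1 (C_P ^ 2)⁻¹

end NonlinearDiffusion

end

/-! The residual is a cubic polynomial in `u`: the diffusion form is linear, and `u³` comes from
`Q(a,b,c)(v) = ∫ a b c v`, symmetric in `a, b, c` and bounded by `C_S⁴` times the product of the
norms (Hölder and the `L⁴` embedding). Its Taylor expansion is therefore exact: with `e = u - ũ`,
`R(u) = R(ũ) + δR(ũ)e + 3α Q(ũ,e,e) + α Q(e,e,e)` (`residualOp_add`). The term `3α ∫ ũ² p²` of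
`δR(ũ)` is nonnegative, so `δR(ũ)` inherits coercivity with constant `Ĉ` from the diffusion form and
the Poincaré inequality, and Lax–Milgram inverts it. The corrector is one Newton step: if `R(u) =
0`, the new error `z` solves `δR(ũ)z = -(3α Q(ũ,e,e) + α Q(e,e,e))` (`apply_sub_corrector`). Testing
with `z` gives the estimate. Both constants in `(*)` come from the single bound `‖u‖_{L⁴} ≤ C
‖∇u‖_{L²}`, proved for test functions by Gagliardo–Nirenberg–Sobolev and extended to the closure. -/

open scoped NNReal
open Filter

namespace NonlinearDiffusion

/-! ### Poincaré and Sobolev inequalities on `H¹₀(Ω)` -/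

section Inequalities

variable {d : ℕ} {Ω : Set (Space d)}

theorem isFiniteMeasure_vol (hΩb : Bornology.IsBounded Ω) : IsFiniteMeasure (vol Ω) :=
  ⟨by simpa using hΩb.measure_lt_top⟩

theorem norm_gradient {φ : Space d → ℝ} (x : Space d) : ‖gradient φ x‖ = ‖fderiv ℝ φ x‖ := by
  simp [gradient]

/-- A compactly supported function on the line is bounded by the `L¹` norm of its derivative. -/
theorem enorm_le_eLpNorm_fderiv_one {φ : Space 1 → ℝ} (hφ : ContDiff ℝ 1 φ)
    (hc : HasCompactSupport φ) (x : Space 1) : ‖φ x‖ₑ ≤ eLpNorm (fderiv ℝ φ) 1 volume := by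
  -- A measure-preserving isometry of the line onto `Space 1` reduces the claim to integrating the
  -- derivative from `-∞`.
  let ι : ℝ →ₗᵢ[ℝ] Space 1 :=
    { toFun := fun t => WithLp.toLp 2 (fun _ => t)
      map_add' := fun _ _ => rfl
      map_smul' := fun _ _ => rfl
      norm_map' := fun t => by
        change ‖(WithLp.toLp 2 (fun _ => t) : Space 1)‖ = ‖t‖
        simp [EuclideanSpace.norm_eq, Real.sqrt_sq_eq_abs] }
  have hι : MeasurePreserving ι volume volume :=
    (PiLp.volume_preserving_toLp (Fin 1)).comp
      (volume_preserving_funUnique (Fin 1) ℝ).symm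
  have hx : ι (x 0) = x := by
    ext i
    rw [Subsingleton.elim i 0]
    rfl
  have hφι : ContDiff ℝ 1 (φ ∘ ι) := hφ.comp ι.toContinuousLinearMap.contDiff
  have hcι : HasCompactSupport (φ ∘ ι) := hc.comp_isClosedEmbedding ι.isometry.isClosedEmbedding
  have hderiv (y : ℝ) : ‖deriv (φ ∘ ι) y‖ₑ ≤ ‖fderiv ℝ φ (ι y)‖ₑ := by
    have h : HasDerivAt (φ ∘ ι) (fderiv ℝ φ (ι y) (ι 1)) y :=
      (hφ.differentiable one_ne_zero (ι y)).hasFDerivAt.comp_hasDerivAt y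
        (ι.toContinuousLinearMap.hasDerivAt)
    rw [h.deriv, enorm_le_iff_norm_le]
    simpa using (fderiv ℝ φ (ι y)).le_opNorm (ι 1)
  calc ‖φ x‖ₑ = ‖(φ ∘ ι) (x 0)‖ₑ := by rw [Function.comp_apply, hx]
    _ ≤ ∫⁻ y in Set.Iic (x 0), ‖deriv (φ ∘ ι) y‖ₑ := hcι.enorm_le_lintegral_Ici_deriv hφι _
    _ ≤ ∫⁻ y, ‖deriv (φ ∘ ι) y‖ₑ := setLIntegral_le_lintegral _ _
    _ ≤ ∫⁻ y, ‖fderiv ℝ φ (ι y)‖ₑ := lintegral_mono hderiv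
    _ = eLpNorm (fderiv ℝ φ) 1 volume := by
      rw [eLpNorm_one_eq_lintegral_enorm]
      exact hι.lintegral_comp (f := fun z => ‖fderiv ℝ φ z‖ₑ)
        (hφ.continuous_fderiv one_ne_zero).measurable.enorm

/-- The Gagliardo–Nirenberg–Sobolev inequality in dimension at most three, for an exponent of the
gradient not above `2`. -/
theorem exists_eLpNorm_four_le_fderiv (hd₁ : 1 ≤ d) (hd₃ : d ≤ 3) (hΩb : Bornology.IsBounded Ω) :
    ∃ p : ℝ≥0∞, p ≤ 2 ∧ ∃ C : ℝ≥0, ∀ φ : Space d → ℝ, ContDiff ℝ 1 φ → HasCompactSupport φ →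
      tsupport φ ⊆ Ω → eLpNorm φ 4 (vol Ω) ≤ C * eLpNorm (fderiv ℝ φ) p volume := by
  have := isFiniteMeasure_vol hΩb
  have key (p : ℝ≥0) (hp₁ : 1 ≤ p) (hp₂ : p ≤ 2) (hpd : (p : ℝ) < d)
      (h : (p : ℝ)⁻¹ - (d : ℝ)⁻¹ ≤ (4 : ℝ)⁻¹) :
      ∃ p : ℝ≥0∞, p ≤ 2 ∧ ∃ C : ℝ≥0, ∀ φ : Space d → ℝ, ContDiff ℝ 1 φ → HasCompactSupport φ →
        tsupport φ ⊆ Ω → eLpNorm φ 4 (vol Ω) ≤ C * eLpNorm (fderiv ℝ φ) p volume := by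
    refine ⟨p, by exact_mod_cast hp₂,
      eLpNormLESNormFDerivOfLeConst ℝ (volume : Measure (Space d)) Ω p 4, fun φ hφ _ hs => ?_⟩
    refine (eLpNorm_mono_measure _ Measure.restrict_le_self).trans ?_
    exact eLpNorm_le_eLpNorm_fderiv_of_le volume hφ ((subset_tsupport φ).trans hs) hp₁
      (by simpa [← NNReal.coe_lt_coe] using hpd) (by simpa using h) hΩb
  -- For `d = 1` no `p ≥ 1` satisfies `p < d`, so the sup bound is used, at the cost of `|Ω|^{1/4}`.
  -- For `d = 2`, `p = 2` is excluded and `p = 4/3` is the equality case `3/4 - 1/2 = 1/4`. For `d =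
  -- 3`, `p = 2` works since `1/2 - 1/3 ≤ 1/4`.
  interval_cases d
  · refine ⟨1, by norm_num, (vol Ω Set.univ ^ (4 : ℝ)⁻¹).toNNReal, fun φ hφ hc _ => ?_⟩
    rw [ENNReal.coe_toNNReal (ENNReal.rpow_ne_top_of_nonneg (by norm_num) (measure_ne_top _ _))]
    refine (eLpNorm_le_of_ae_enorm_bound
      (ae_of_all _ (enorm_le_eLpNorm_fderiv_one hφ hc))).trans (le_of_eq ?_)
    rw [mul_comm]
    norm_num
  · exact key (4 / 3) (by rw [← NNReal.coe_le_coe]; norm_num) (by rw [← NNReal.coe_le_coe]; norm_num)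
      (by norm_num) (by norm_num)
  · exact key 2 (by norm_num) le_rfl (by norm_num) (by norm_num)

/-- The derivative is supported in `Ω`, which has finite measure, so Hölder raises its exponent from
`p` to `2`. -/
theorem exists_eLpNorm_four_le_gradient (hd₁ : 1 ≤ d) (hd₃ : d ≤ 3)
    (hΩb : Bornology.IsBounded Ω) :
    ∃ C : ℝ≥0, ∀ φ : Space d → ℝ, ContDiff ℝ 1 φ → HasCompactSupport φ →
      tsupport φ ⊆ Ω → eLpNorm φ 4 (vol Ω) ≤ C * eLpNorm (gradient φ) 2 (vol Ω) := by
  have := isFiniteMeasure_vol hΩb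
  obtain ⟨p, hp, C, hC⟩ := exists_eLpNorm_four_le_fderiv hd₁ hd₃ hΩb
  -- At `p = 0` the seminorm is zero by convention, and the Hölder exponent below would be negative
  -- because `1 / 0 = 0`.
  by_cases hp₀ : p = 0
  · refine ⟨0, fun φ hφ hc hs => (hC φ hφ hc hs).trans ?_⟩
    simp [hp₀]
  have hexp : 0 ≤ 1 / p.toReal - 1 / (2 : ℝ≥0∞).toReal := by
    have hp_pos : 0 < p.toReal := ENNReal.toReal_pos hp₀ (ne_top_of_le_ne_top (by simp) hp)
    exact sub_nonneg.2 (one_div_le_one_div_of_le hp_pos (ENNReal.toReal_mono (by simp) hp))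
  refine ⟨C * (vol Ω Set.univ ^ (1 / p.toReal - 1 / (2 : ℝ≥0∞).toReal)).toNNReal,
    fun φ hφ hc hs => (hC φ hφ hc hs).trans ?_⟩
  rw [ENNReal.coe_mul, ENNReal.coe_toNNReal
    (ENNReal.rpow_ne_top_of_nonneg hexp (measure_ne_top _ _)), mul_assoc]
  gcongr
  rw [eLpNorm_congr_norm_ae (ae_of_all _ norm_gradient),
    ← eLpNorm_restrict_eq_of_support_subset (f := fderiv ℝ φ) (
    ((subset_tsupport _).trans (tsupport_fderiv_subset ℝ)).trans hs)]
  refine (eLpNorm_le_eLpNorm_mul_rpow_measure_univ hp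
    (hφ.continuous_fderiv one_ne_zero).aestronglyMeasurable).trans (le_of_eq ?_)
  rw [mul_comm]

theorem gradient_add {φ ψ : Space d → ℝ} (hφ : Differentiable ℝ φ) (hψ : Differentiable ℝ ψ) :
    gradient (φ + ψ) = gradient φ + gradient ψ := by
  ext1 x
  simp [gradient, fderiv_add (hφ x) (hψ x)]

theorem gradient_const_smul {φ : Space d → ℝ} (hφ : Differentiable ℝ φ) (c : ℝ) :
    gradient (c • φ) = c • gradient φ := by
  ext1 x
  simp [gradient, fderiv_const_smul (hφ x) c]

/-- Linear combinations of test functions are test functions, so approximants taken from the span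
are genuine pairs `(φ, ∇φ)`, to which the smooth inequality applies. -/
theorem span_testPairs_subset : (Submodule.span ℝ (testPairs Ω) : Set (L2Pairs Ω)) ⊆ testPairs Ω := by
  intro w hw
  induction hw using Submodule.span_induction with
  | mem w hw => exact hw
  | zero =>
    refine ⟨0, contDiff_const, HasCompactSupport.zero, by simp [tsupport], ?_, ?_⟩
    · exact Lp.coeFn_zero _ _ _
    · have : gradient (0 : Space d → ℝ) = 0 := by ext1 x; simp [gradient]
      rw [this]
      exact Lp.coeFn_zero _ _ _
  | add w₁ w₂ _ _ h₁ h₂ =>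
    obtain ⟨φ, hφ, hφc, hφs, hφ₁, hφ₂⟩ := h₁
    obtain ⟨ψ, hψ, hψc, hψs, hψ₁, hψ₂⟩ := h₂
    refine ⟨φ + ψ, hφ.add hψ, hφc.add hψc,
      (tsupport_add φ ψ).trans (Set.union_subset hφs hψs), ?_, ?_⟩
    · exact (Lp.coeFn_add _ _).trans (hφ₁.add hψ₁)
    · rw [gradient_add (hφ.differentiable (by simp)) (hψ.differentiable (by simp))]
      exact (Lp.coeFn_add _ _).trans (hφ₂.add hψ₂)
  | smul c w _ h =>
    obtain ⟨φ, hφ, hφc, hφs, hφ₁, hφ₂⟩ := h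
    refine ⟨c • φ, contDiff_const.smul hφ, hφc.smul_left (f := fun _ => c),
      (tsupport_smul_subset_right (fun _ => c) φ).trans hφs, ?_, ?_⟩
    · exact (Lp.coeFn_smul _ _).trans (hφ₁.const_smul c)
    · rw [gradient_const_smul (hφ.differentiable (by simp))]
      exact (Lp.coeFn_smul _ _).trans (hφ₂.const_smul c)

/-- `‖u‖_{L⁴} ≤ C ‖∇u‖_{L²}` on `H¹₀(Ω)`. -/
theorem exists_eLpNorm_four_le_norm_grad (hd₁ : 1 ≤ d) (hd₃ : d ≤ 3)
    (hΩb : Bornology.IsBounded Ω) :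
    ∃ C : ℝ≥0, ∀ u : H10 Ω, eLpNorm (toFun u) 4 (vol Ω) ≤ C * ‖grad u‖ₑ := by
  obtain ⟨C, hC⟩ := exists_eLpNorm_four_le_gradient hd₁ hd₃ hΩb
  refine ⟨C, fun u => ?_⟩
  obtain ⟨w, hw, hlim⟩ := mem_closure_iff_seq_limit.1 u.2
  have hbound (n : ℕ) : eLpNorm (w n).fst 4 (vol Ω) ≤ C * ‖(w n).snd‖ₑ := by
    obtain ⟨φ, hφ, hφc, hφs, hφ₁, hφ₂⟩ := span_testPairs_subset (hw n)
    rw [Lp.enorm_def, eLpNorm_congr_ae hφ₁, eLpNorm_congr_ae hφ₂]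
    exact hC φ (hφ.of_le (by simp)) hφc hφs
  have hfst : Tendsto (fun n => (w n).fst) atTop (𝓝 (toFun u)) :=
    ((WithLp.continuous_fst 2 _ _).tendsto _).comp hlim
  have hsnd : Tendsto (fun n => (w n).snd) atTop (𝓝 (grad u)) :=
    ((WithLp.continuous_snd 2 _ _).tendsto _).comp hlim
  -- The approximants converge only in `L²`. This gives convergence in measure, under which the `L⁴`
  -- norm is lower semicontinuous; the slack `ε` turns the convergent right-hand sides into one
  -- eventual bound.
  refine ENNReal.le_of_forall_pos_le_add fun ε hε _ => ?_
  have hrhs : Tendsto (fun n => C * ‖(w n).snd‖ₑ) atTop (𝓝 (C * ‖grad u‖ₑ)) :=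
    ENNReal.Tendsto.const_mul hsnd.enorm (Or.inr ENNReal.coe_ne_top)
  refine eLpNorm_le_of_tendstoInMeasure ?_ (tendstoInMeasure_of_tendsto_Lp hfst)
    fun n => Lp.aestronglyMeasurable _
  have hlt : C * ‖grad u‖ₑ < C * ‖grad u‖ₑ + ε :=
    ENNReal.lt_add_right (ENNReal.mul_ne_top ENNReal.coe_ne_top enorm_ne_top) (by simpa using hε.ne')
  filter_upwards [hrhs.eventually (gt_mem_nhds hlt)] with n hn
  exact (hbound n).trans hn.le

theorem norm_sq_eq (u : H10 Ω) : ‖u‖ ^ 2 = ‖toFun u‖ ^ 2 + ‖grad u‖ ^ 2 :=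
  WithLp.prod_norm_sq_eq_of_L2 (u : L2Pairs Ω)

theorem norm_grad_le (u : H10 Ω) : ‖grad u‖ ≤ ‖u‖ := WithLp.norm_snd_le (x := (u : L2Pairs Ω))

theorem exists_isSobolevConst (hd₁ : 1 ≤ d) (hd₃ : d ≤ 3) (hΩb : Bornology.IsBounded Ω) :
    ∃ C_S : ℝ, IsSobolevConst Ω C_S := by
  obtain ⟨C, hC⟩ := exists_eLpNorm_four_le_norm_grad hd₁ hd₃ hΩb
  -- `C` may vanish; adding `1` makes the constant positive.
  refine ⟨C + 1, by positivity, fun u => (hC u).trans ?_⟩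
  rw [← ofReal_norm, ← ENNReal.ofReal_coe_nnreal, ← ENNReal.ofReal_mul C.coe_nonneg]
  have := norm_grad_le u
  gcongr
  simp

theorem exists_isPoincareConst (hd₁ : 1 ≤ d) (hd₃ : d ≤ 3) (hΩb : Bornology.IsBounded Ω) :
    ∃ C_P : ℝ, IsPoincareConst Ω C_P := by
  have := isFiniteMeasure_vol hΩb
  obtain ⟨C, hC⟩ := exists_eLpNorm_four_le_norm_grad hd₁ hd₃ hΩb
  set V : ℝ≥0∞ := vol Ω Set.univ ^ (1 / (2 : ℝ≥0∞).toReal - 1 / (4 : ℝ≥0∞).toReal)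
  have hV : V ≠ ⊤ := ENNReal.rpow_ne_top_of_nonneg (by norm_num) (measure_ne_top _ _)
  refine ⟨C * V.toReal + 1, by positivity, fun u => ?_⟩
  have h : ‖toFun u‖ₑ ≤ C * ‖grad u‖ₑ * V := by
    rw [Lp.enorm_def (toFun u)]
    refine (eLpNorm_le_eLpNorm_mul_rpow_measure_univ (q := 4) (by norm_num)
      (Lp.aestronglyMeasurable _)).trans ?_
    gcongr
    exact hC u
  have h' := ENNReal.toReal_mono
    (ENNReal.mul_ne_top (ENNReal.mul_ne_top ENNReal.coe_ne_top enorm_ne_top) hV) h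
  rw [ENNReal.toReal_mul, ENNReal.toReal_mul, toReal_enorm, toReal_enorm, ENNReal.coe_toReal] at h'
  nlinarith [norm_nonneg (grad u)]

end Inequalities

end NonlinearDiffusion

namespace NonlinearDiffusion

/-! ### The quartic, diffusion and load forms as bounded multilinear maps -/

section Forms

variable {d : ℕ} {Ω : Set (Space d)}

theorem coeFn_toFun_add (u v : H10 Ω) :
    ⇑(toFun (u + v)) =ᵐ[vol Ω] fun x => toFun u x + toFun v x :=
  Lp.coeFn_add (toFun u) (toFun v)

theorem coeFn_toFun_smul (c : ℝ) (u : H10 Ω) :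
    ⇑(toFun (c • u)) =ᵐ[vol Ω] fun x => c * toFun u x :=
  Lp.coeFn_smul c (toFun u)

theorem coeFn_grad_add (u v : H10 Ω) :
    ⇑(grad (u + v)) =ᵐ[vol Ω] fun x => grad u x + grad v x :=
  Lp.coeFn_add (grad u) (grad v)

theorem coeFn_grad_smul (c : ℝ) (u : H10 Ω) :
    ⇑(grad (c • u)) =ᵐ[vol Ω] fun x => c • grad u x :=
  Lp.coeFn_smul c (grad u)

theorem memLp_toFun (u : H10 Ω) : MemLp (toFun u) 2 (vol Ω) := Lp.memLp _

section Quartic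

variable {C_S : ℝ}

theorem IsSobolevConst.memLp_four (hS : IsSobolevConst Ω C_S) (u : H10 Ω) :
    MemLp (toFun u) 4 (vol Ω) :=
  ⟨Lp.aestronglyMeasurable _, (hS.2 u).trans_lt ENNReal.ofReal_lt_top⟩

theorem holderTriple_four_four_two : ENNReal.HolderTriple 4 4 2 := by
  constructor
  rw [← ENNReal.toReal_eq_toReal_iff' (by simp) (by simp), ENNReal.toReal_add (by simp) (by simp)]
  norm_num

theorem eLpNorm_mul_le {X : Type*} [MeasurableSpace X] {μ : Measure X} {a b : X → ℝ}
    (ha : AEStronglyMeasurable a μ) (hb : AEStronglyMeasurable b μ) (p q r : ℝ≥0∞)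
    [ENNReal.HolderTriple p q r] :
    eLpNorm (fun x => a x * b x) r μ ≤ eLpNorm a p μ * eLpNorm b q μ := by
  have h := eLpNorm_le_eLpNorm_mul_eLpNorm_of_nnnorm (p := p) (q := q) (r := r) ha hb
    (fun s t => s * t) 1 (ae_of_all _ fun x => by simp)
  rwa [ENNReal.coe_one, one_mul] at h

/-- Cauchy–Schwarz on the two paired products, then Hölder `4, 4 → 2` on each pair. -/
theorem eLpNorm_mul_mul_mul_le {X : Type*} [MeasurableSpace X] {μ : Measure X} {a b c v : X → ℝ}
    (ha : AEStronglyMeasurable a μ) (hb : AEStronglyMeasurable b μ)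
    (hc : AEStronglyMeasurable c μ) (hv : AEStronglyMeasurable v μ) :
    eLpNorm (fun x => a x * b x * (c x * v x)) 1 μ ≤
      eLpNorm a 4 μ * eLpNorm b 4 μ * (eLpNorm c 4 μ * eLpNorm v 4 μ) := by
  have := holderTriple_four_four_two
  exact (eLpNorm_mul_le (ha.mul hb) (hc.mul hv) 2 2 1).trans
    (mul_le_mul' (eLpNorm_mul_le ha hb 4 4 2) (eLpNorm_mul_le hc hv 4 4 2))

theorem IsSobolevConst.integrable_mul (hS : IsSobolevConst Ω C_S) (a b c v : H10 Ω) :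
    Integrable (fun x => toFun a x * toFun b x * (toFun c x * toFun v x)) (vol Ω) := by
  have := holderTriple_four_four_two
  have hab : MemLp (⇑(toFun a) * ⇑(toFun b)) 2 (vol Ω) := (hS.memLp_four b).mul (hS.memLp_four a)
  have hcv : MemLp (⇑(toFun c) * ⇑(toFun v)) 2 (vol Ω) := (hS.memLp_four v).mul (hS.memLp_four c)
  exact hab.integrable_mul hcv

theorem IsSobolevConst.abs_integral_le (hS : IsSobolevConst Ω C_S) (a b c v : H10 Ω) :
    |∫ x, toFun a x * toFun b x * (toFun c x * toFun v x) ∂(vol Ω)| ≤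
      C_S ^ 4 * ‖a‖ * ‖b‖ * ‖c‖ * ‖v‖ := by
  have hnonneg (u : H10 Ω) : 0 ≤ C_S * ‖u‖ := mul_nonneg hS.1.le (norm_nonneg u)
  have h := (eLpNorm_mul_mul_mul_le (Lp.aestronglyMeasurable (toFun a))
    (Lp.aestronglyMeasurable (toFun b)) (Lp.aestronglyMeasurable (toFun c))
    (Lp.aestronglyMeasurable (toFun v))).trans
    (mul_le_mul' (mul_le_mul' (hS.2 a) (hS.2 b)) (mul_le_mul' (hS.2 c) (hS.2 v)))
  rw [← ENNReal.ofReal_mul (hnonneg a), ← ENNReal.ofReal_mul (hnonneg c),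
    ← ENNReal.ofReal_mul (mul_nonneg (hnonneg a) (hnonneg b)),
    eLpNorm_one_eq_lintegral_enorm] at h
  have h' := (enorm_integral_le_lintegral_enorm _).trans h
  rw [← ofReal_norm, ENNReal.ofReal_le_ofReal_iff
    (mul_nonneg (mul_nonneg (hnonneg a) (hnonneg b)) (mul_nonneg (hnonneg c) (hnonneg v)))] at h'
  refine h'.trans (le_of_eq ?_)
  ring

/-- The bilinear form `(c, v) ↦ ∫_Ω a b c v dx`. -/
noncomputable def quarticForm (hS : IsSobolevConst Ω C_S) (a b : H10 Ω) : H10 Ω →L[ℝ] StrongDual ℝ (H10 Ω) :=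
  LinearMap.mkContinuous₂
    (LinearMap.mk₂ ℝ (fun c v : H10 Ω =>
        ∫ x, toFun a x * toFun b x * (toFun c x * toFun v x) ∂(vol Ω))
      (fun c c' v => by
        rw [← integral_add (hS.integrable_mul a b c v) (hS.integrable_mul a b c' v)]
        refine integral_congr_ae ?_
        filter_upwards [coeFn_toFun_add c c'] with x hx
        rw [hx]
        ring)
      (fun t c v => by
        rw [smul_eq_mul, ← integral_const_mul]
        refine integral_congr_ae ?_
        filter_upwards [coeFn_toFun_smul t c] with x hx
        rw [hx]
        ring)
      (fun c v v' => by
        rw [← integral_add (hS.integrable_mul a b c v) (hS.integrable_mul a b c v')]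
        refine integral_congr_ae ?_
        filter_upwards [coeFn_toFun_add v v'] with x hx
        rw [hx]
        ring)
      (fun t c v => by
        rw [smul_eq_mul, ← integral_const_mul]
        refine integral_congr_ae ?_
        filter_upwards [coeFn_toFun_smul t v] with x hx
        rw [hx]
        ring))
    (C_S ^ 4 * ‖a‖ * ‖b‖) (hS.abs_integral_le a b)

variable (hS : IsSobolevConst Ω C_S)

theorem quarticForm_apply (a b c v : H10 Ω) : quarticForm hS a b c v =
    ∫ x, toFun a x * toFun b x * (toFun c x * toFun v x) ∂(vol Ω) := rfl

theorem abs_quarticForm_le (a b c v : H10 Ω) :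
    |quarticForm hS a b c v| ≤ C_S ^ 4 * ‖a‖ * ‖b‖ * ‖c‖ * ‖v‖ :=
  hS.abs_integral_le a b c v

attribute [irreducible] quarticForm

/-- This transposition and the next generate all permutations of the first three arguments. They
carry linearity, built in only for the third argument, over to the other two. -/
theorem quarticForm_comm (a b c : H10 Ω) : quarticForm hS a b c = quarticForm hS b a c := by
  ext v
  simp only [quarticForm_apply, mul_comm (toFun a _)]

theorem quarticForm_comm_right (a b c : H10 Ω) :
    quarticForm hS a b c = quarticForm hS a c b := by
  ext v
  simp only [quarticForm_apply]
  congr 1 with x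
  ring

theorem quarticForm_self_add (u q : H10 Ω) :
    quarticForm hS (u + q) (u + q) (u + q) = quarticForm hS u u u +
      (3 : ℝ) • quarticForm hS u u q + (3 : ℝ) • quarticForm hS u q q + quarticForm hS q q q := by
  have hmid (a b b' c : H10 Ω) :
      quarticForm hS a (b + b') c = quarticForm hS a b c + quarticForm hS a b' c := by
    rw [quarticForm_comm_right, map_add, quarticForm_comm_right hS a c,
      quarticForm_comm_right hS a c]
  have hleft (a a' b c : H10 Ω) :
      quarticForm hS (a + a') b c = quarticForm hS a b c + quarticForm hS a' b c := by
    rw [quarticForm_comm, hmid, quarticForm_comm hS b, quarticForm_comm hS b]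
  simp only [hleft, hmid, map_add]
  have huqu : quarticForm hS u q u = quarticForm hS u u q := quarticForm_comm_right hS u q u
  have hquu : quarticForm hS q u u = quarticForm hS u u q := (quarticForm_comm hS q u u).trans huqu
  have hquq : quarticForm hS q u q = quarticForm hS u q q := quarticForm_comm hS q u q
  have hqqu : quarticForm hS q q u = quarticForm hS u q q :=
    (quarticForm_comm_right hS q q u).trans hquq
  simp only [huqu, hquu, hquq, hqqu]
  module

theorem quarticForm_smul_smul (t : ℝ) (a p q : H10 Ω) :
    quarticForm hS a (t • p) (t • q) = t ^ 2 • quarticForm hS a p q := by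
  rw [map_smul, quarticForm_comm_right, map_smul, quarticForm_comm_right, smul_smul, sq]

theorem quarticForm_smul_self (t : ℝ) (p : H10 Ω) :
    quarticForm hS (t • p) (t • p) (t • p) = t ^ 3 • quarticForm hS p p p := by
  rw [quarticForm_smul_smul, quarticForm_comm, quarticForm_comm_right, map_smul, smul_smul,
    ← pow_succ]

end Quartic

section Diffusion

variable {m : Space d → ℝ}

theorem integrable_mul_inner_grad (hm : MemLp m ∞ (vol Ω)) (p v : H10 Ω) :
    Integrable (fun x => m x * ⟪grad p x, grad v x⟫_ℝ) (vol Ω) :=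
  hm.integrable_mul (memLp_one_iff_integrable.2 (L2.integrable_inner (grad p) (grad v)))

theorem abs_integral_mul_inner_grad_le (hm : MemLp m ∞ (vol Ω)) (p v : H10 Ω) :
    |∫ x, m x * ⟪grad p x, grad v x⟫_ℝ ∂(vol Ω)| ≤
      (eLpNorm m ∞ (vol Ω)).toReal * ‖p‖ * ‖v‖ := by
  have hinner : eLpNorm (fun x => ⟪grad p x, grad v x⟫_ℝ) 1 (vol Ω) ≤ ‖p‖ₑ * ‖v‖ₑ := by
    refine (eLpNorm_le_eLpNorm_mul_eLpNorm_of_nnnorm (p := 2) (q := 2) (r := 1)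
      (Lp.aestronglyMeasurable (grad p)) (Lp.aestronglyMeasurable (grad v))
      (fun a b => ⟪a, b⟫_ℝ) 1 (ae_of_all _ fun x => ?_)).trans ?_
    · simpa using nnnorm_inner_le_nnnorm (𝕜 := ℝ) (grad p x) (grad v x)
    · rw [ENNReal.coe_one, one_mul, ← Lp.enorm_def, ← Lp.enorm_def]
      exact mul_le_mul' (enorm_le_iff_norm_le.2 (norm_grad_le p))
        (enorm_le_iff_norm_le.2 (norm_grad_le v))
  have h : ‖∫ x, m x * ⟪grad p x, grad v x⟫_ℝ ∂(vol Ω)‖ₑ ≤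
      eLpNorm m ∞ (vol Ω) * (‖p‖ₑ * ‖v‖ₑ) := by
    refine (enorm_integral_le_lintegral_enorm _).trans ?_
    rw [← eLpNorm_one_eq_lintegral_enorm]
    exact (eLpNorm_mul_le hm.1 (L2.integrable_inner (grad p) (grad v)).aestronglyMeasurable
      ∞ 1 1).trans
      (mul_le_mul' le_rfl hinner)
  have h' := ENNReal.toReal_mono
    (ENNReal.mul_ne_top hm.2.ne (ENNReal.mul_ne_top enorm_ne_top enorm_ne_top)) h
  simpa [ENNReal.toReal_mul, mul_assoc] using h'

/-- The bilinear form `(p, v) ↦ ∫_Ω m ∇p · ∇v dx`. -/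
noncomputable def diffusionForm (hm : MemLp m ∞ (vol Ω)) : H10 Ω →L[ℝ] StrongDual ℝ (H10 Ω) :=
  LinearMap.mkContinuous₂
    (LinearMap.mk₂ ℝ (fun p v : H10 Ω => ∫ x, m x * ⟪grad p x, grad v x⟫_ℝ ∂(vol Ω))
      (fun p p' v => by
        rw [← integral_add (integrable_mul_inner_grad hm p v) (integrable_mul_inner_grad hm p' v)]
        refine integral_congr_ae ?_
        filter_upwards [coeFn_grad_add p p'] with x hx
        rw [hx, inner_add_left, mul_add])
      (fun t p v => by
        rw [smul_eq_mul, ← integral_const_mul]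
        refine integral_congr_ae ?_
        filter_upwards [coeFn_grad_smul t p] with x hx
        rw [hx, real_inner_smul_left]
        ring)
      (fun p v v' => by
        rw [← integral_add (integrable_mul_inner_grad hm p v) (integrable_mul_inner_grad hm p v')]
        refine integral_congr_ae ?_
        filter_upwards [coeFn_grad_add v v'] with x hx
        rw [hx, inner_add_right, mul_add])
      (fun t p v => by
        rw [smul_eq_mul, ← integral_const_mul]
        refine integral_congr_ae ?_
        filter_upwards [coeFn_grad_smul t v] with x hx
        rw [hx, real_inner_smul_right]
        ring))
    (eLpNorm m ∞ (vol Ω)).toReal (abs_integral_mul_inner_grad_le hm)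

theorem diffusionForm_apply (hm : MemLp m ∞ (vol Ω)) (p v : H10 Ω) :
    diffusionForm hm p v = ∫ x, m x * ⟪grad p x, grad v x⟫_ℝ ∂(vol Ω) := rfl

attribute [irreducible] diffusionForm

theorem le_diffusionForm_self (hm : MemLp m ∞ (vol Ω)) {m_lw : ℝ}
    (hlw : ∀ᵐ x ∂(vol Ω), m_lw ≤ m x) (p : H10 Ω) :
    m_lw * ‖grad p‖ ^ 2 ≤ diffusionForm hm p p := by
  rw [diffusionForm_apply, ← real_inner_self_eq_norm_sq, L2.inner_def, ← integral_const_mul]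
  refine integral_mono_ae ((L2.integrable_inner _ _).const_mul _)
    (integrable_mul_inner_grad hm p p) ?_
  filter_upwards [hlw] with x hx
  exact mul_le_mul_of_nonneg_right hx real_inner_self_nonneg

end Diffusion

/-- The functional `v ↦ ∫_Ω f v dx`. -/
noncomputable def loadFunctional {f : Space d → ℝ} (hf : MemLp f 2 (vol Ω)) : StrongDual ℝ (H10 Ω) :=
  (innerSL ℝ (hf.toLp f)).comp ((WithLp.fstL 2 ℝ _ _).comp (H10 Ω).subtypeL)

theorem integrable_mul_toFun {f : Space d → ℝ} (hf : MemLp f 2 (vol Ω)) (v : H10 Ω) :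
    Integrable (fun x => f x * toFun v x) (vol Ω) :=
  hf.integrable_mul (memLp_toFun v)

theorem loadFunctional_apply {f : Space d → ℝ} (hf : MemLp f 2 (vol Ω)) (v : H10 Ω) :
    loadFunctional hf v = ∫ x, f x * toFun v x ∂(vol Ω) := by
  change ⟪hf.toLp f, toFun v⟫_ℝ = _
  rw [L2.inner_def]
  refine integral_congr_ae ?_
  filter_upwards [hf.coeFn_toLp] with x hx
  rw [hx]
  simp [mul_comm]

end Forms

end NonlinearDiffusion

/-! ### Abstract Lax–Milgram, Newton step and line derivative -/

namespace NonlinearDiffusion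

/-- The Lax–Milgram theorem, as an isomorphism onto the dual space. -/
theorem exists_equiv_dual_of_isCoercive {V : Type*} [NormedAddCommGroup V] [InnerProductSpace ℝ V]
    [CompleteSpace V] {B : V →L[ℝ] StrongDual ℝ V} (hB : IsCoercive B) :
    ∃ A : V ≃L[ℝ] StrongDual ℝ V, ∀ p, A p = B p := by
  -- Lax–Milgram gives an automorphism of `V`; the Riesz map carries it to the dual.
  have hBE (p : V) : B p = InnerProductSpace.toDual ℝ V (hB.continuousLinearEquivOfBilin p) := by
    ext v
    simp
  have hinj : Function.Injective B := fun p q h => by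
    rw [hBE, hBE] at h
    simpa using h
  have hsurj : Function.Surjective B := fun l =>
    ⟨hB.continuousLinearEquivOfBilin.symm ((InnerProductSpace.toDual ℝ V).symm l), by
      rw [hBE]; simp⟩
  exact ⟨.ofBijective B (LinearMap.ker_eq_bot.2 hinj) (LinearMap.range_eq_top.2 hsurj),
    fun _ => rfl⟩

/-- Since the derivative is the bijection `A`, the choice made by `Function.invFun` is the true
inverse. -/
theorem corrector_eq {U : Type*} [NormedAddCommGroup U] [NormedSpace ℝ U]
    {R : U → StrongDual ℝ U} {w : U} {A : U ≃L[ℝ] StrongDual ℝ U}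
    (hA : ∀ p, HasLineDerivAt ℝ R (A p) w p) : corrector R w = w - A.symm (R w) := by
  have h : (fun p : U => lineDeriv ℝ R w p) = A := funext fun p => (hA p).lineDeriv
  rw [corrector, h]
  congr 1
  exact A.injective (by rw [Function.invFun_eq (A.surjective _), A.apply_symm_apply])

/-- Newton error identity: the linear part of the expansion cancels, leaving only the Taylor
remainder `N`. -/
theorem apply_sub_corrector {U : Type*} [NormedAddCommGroup U] [NormedSpace ℝ U]
    {R : U → StrongDual ℝ U} {u w : U} {A : U ≃L[ℝ] StrongDual ℝ U} {N : StrongDual ℝ U}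
    (hA : ∀ p, HasLineDerivAt ℝ R (A p) w p) (hu : R u = 0) (h : R u = R w + A (u - w) + N) :
    A (u - corrector R w) = -N := by
  rw [corrector_eq hA, sub_sub_eq_add_sub, add_sub_right_comm, map_add, A.apply_symm_apply,
    eq_neg_iff_add_eq_zero, ← hu, h, add_comm (A _)]

theorem hasLineDerivAt_of_cubic {U E : Type*} [AddCommGroup U] [Module ℝ U]
    [NormedAddCommGroup E] [NormedSpace ℝ E] {R : U → E} {u p : U} {a b c : E}
    (h : ∀ t : ℝ, R (u + t • p) = R u + t • a + (t ^ 2 • b + t ^ 3 • c)) :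
    HasLineDerivAt ℝ R a u p := by
  have h₁ := (hasDerivAt_id (0 : ℝ)).smul_const a
  have h₂ := (hasDerivAt_pow 2 (0 : ℝ)).smul_const b
  have h₃ := (hasDerivAt_pow 3 (0 : ℝ)).smul_const c
  rw [HasLineDerivAt, funext h]
  convert! (h₁.const_add (R u)).add (h₂.add h₃) using 1
  simp

/-! ### The residual: exact expansion, coercivity and error bound -/

section Residual

variable {d : ℕ} {Ω : Set (Space d)}

instance : CompleteSpace (H10 Ω) :=
  (Submodule.isClosed_topologicalClosure _).completeSpace_coe

variable {κ₀ α C_S : ℝ} {f m : Space d → ℝ}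

theorem isResidual_add_sub (hS : IsSobolevConst Ω C_S) (hm : MemLp m ∞ (vol Ω))
    (hf : MemLp f 2 (vol Ω)) (u : H10 Ω) :
    IsResidual κ₀ α f m u
      (κ₀ • diffusionForm hm u + α • quarticForm hS u u u - loadFunctional hf) := by
  intro v
  have h₁ := (integrable_mul_inner_grad hm u v).const_mul κ₀
  have h₂ := (hS.integrable_mul u u u v).const_mul α
  have hform : formIntegrand κ₀ α m u v = fun x => κ₀ * (m x * ⟪grad u x, grad v x⟫_ℝ) +
      α * (toFun u x * toFun u x * (toFun u x * toFun v x)) := by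
    ext x
    rw [formIntegrand]
    ring
  refine ⟨hform ▸ h₁.add h₂, integrable_mul_toFun hf v, ?_⟩
  rw [hform, integral_add h₁ h₂, integral_const_mul, integral_const_mul,
    ← diffusionForm_apply hm, ← quarticForm_apply hS, ← loadFunctional_apply hf]
  rfl

theorem isResidual_residualOp (hS : IsSobolevConst Ω C_S) (hm : MemLp m ∞ (vol Ω))
    (hf : MemLp f 2 (vol Ω)) (u : H10 Ω) :
    IsResidual κ₀ α f m u (residualOp κ₀ α f m u) := by
  have h : ∃ l : StrongDual ℝ (H10 Ω), IsResidual κ₀ α f m u l :=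
    ⟨_, isResidual_add_sub hS hm hf u⟩
  rw [residualOp, dif_pos h]
  exact h.choose_spec

/-- `IsResidual` prescribes the value at every `v`, so the functional is unique and the chosen one
is the explicit one. -/
theorem residualOp_eq (hS : IsSobolevConst Ω C_S) (hm : MemLp m ∞ (vol Ω))
    (hf : MemLp f 2 (vol Ω)) (u : H10 Ω) :
    residualOp κ₀ α f m u =
      κ₀ • diffusionForm hm u + α • quarticForm hS u u u - loadFunctional hf := by
  refine ContinuousLinearMap.ext fun v => ?_
  rw [(isResidual_residualOp hS hm hf u v).2.2, (isResidual_add_sub hS hm hf u v).2.2]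

/-- The derivative `p ↦ (v ↦ ∫_Ω κ₀ m ∇p · ∇v + 3 α u² p v dx)` of the residual at `u`. -/
noncomputable def residualDeriv (κ₀ α : ℝ) (hS : IsSobolevConst Ω C_S) (hm : MemLp m ∞ (vol Ω))
    (u : H10 Ω) : H10 Ω →L[ℝ] StrongDual ℝ (H10 Ω) :=
  κ₀ • diffusionForm hm + (3 * α) • quarticForm hS u u

theorem residualDeriv_apply (hS : IsSobolevConst Ω C_S) (hm : MemLp m ∞ (vol Ω)) (u p : H10 Ω) :
    residualDeriv κ₀ α hS hm u p =
      κ₀ • diffusionForm hm p + (3 * α) • quarticForm hS u u p := rfl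

theorem residualOp_add (hS : IsSobolevConst Ω C_S) (hm : MemLp m ∞ (vol Ω))
    (hf : MemLp f 2 (vol Ω)) (u q : H10 Ω) :
    residualOp κ₀ α f m (u + q) = residualOp κ₀ α f m u + residualDeriv κ₀ α hS hm u q +
      ((3 * α) • quarticForm hS u q q + α • quarticForm hS q q q) := by
  have hadd : diffusionForm hm (u + q) = diffusionForm hm u + diffusionForm hm q :=
    (diffusionForm hm).map_add u q
  rw [residualOp_eq hS hm hf, residualOp_eq hS hm hf, residualDeriv_apply]
  simp only [hadd, quarticForm_self_add hS u q]
  module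

theorem hasLineDerivAt_residualOp (hS : IsSobolevConst Ω C_S) (hm : MemLp m ∞ (vol Ω))
    (hf : MemLp f 2 (vol Ω)) (u p : H10 Ω) :
    HasLineDerivAt ℝ (residualOp κ₀ α f m) (residualDeriv κ₀ α hS hm u p) u p := by
  have h (t : ℝ) : residualOp κ₀ α f m (u + t • p) =
      residualOp κ₀ α f m u + t • residualDeriv κ₀ α hS hm u p +
        (t ^ 2 • ((3 * α) • quarticForm hS u p p) + t ^ 3 • (α • quarticForm hS p p p)) := by
    have hsmul : residualDeriv κ₀ α hS hm u (t • p) = t • residualDeriv κ₀ α hS hm u p :=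
      (residualDeriv κ₀ α hS hm u).map_smul t p
    rw [residualOp_add hS hm hf, quarticForm_smul_smul, quarticForm_smul_self]
    simp only [hsmul]
    module
  exact hasLineDerivAt_of_cubic h

theorem coercivityConst_pos {m_lw C_P : ℝ} (hκ : 0 < κ₀) (hlw : 0 < m_lw) (hP : 0 < C_P) :
    0 < coercivityConst κ₀ m_lw C_P := by
  unfold coercivityConst
  have : 0 < min 1 (C_P ^ 2)⁻¹ := lt_min one_pos (by positivity)
  positivity

/-- Each of the two parts of the `H¹` norm costs one `‖∇p‖²`; this is the origin of the `1/2` in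
`coercivityConst`. -/
theorem IsPoincareConst.min_mul_norm_sq_le {C_P : ℝ} (hP : IsPoincareConst Ω C_P) (p : H10 Ω) :
    min 1 (C_P ^ 2)⁻¹ * ‖p‖ ^ 2 ≤ 2 * ‖grad p‖ ^ 2 := by
  have hCP := hP.1
  have h₁ : min 1 (C_P ^ 2)⁻¹ * ‖grad p‖ ^ 2 ≤ 1 * ‖grad p‖ ^ 2 := by
    gcongr
    exact min_le_left _ _
  have h₂ : min 1 (C_P ^ 2)⁻¹ * ‖toFun p‖ ^ 2 ≤ ‖grad p‖ ^ 2 := by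
    calc min 1 (C_P ^ 2)⁻¹ * ‖toFun p‖ ^ 2 ≤ (C_P ^ 2)⁻¹ * (C_P * ‖grad p‖) ^ 2 := by
          gcongr
          · exact min_le_right _ _
          · exact hP.2 p
      _ = ‖grad p‖ ^ 2 := by field_simp
  rw [norm_sq_eq]
  linarith

theorem quarticForm_self_nonneg (hS : IsSobolevConst Ω C_S) (u p : H10 Ω) :
    0 ≤ quarticForm hS u u p p := by
  rw [quarticForm_apply]
  exact integral_nonneg fun x => mul_nonneg (mul_self_nonneg _) (mul_self_nonneg _)

theorem coercivityConst_mul_le {m_lw C_P : ℝ} (hκ : 0 < κ₀) (hα : 0 < α) (hlw : 0 < m_lw)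
    (hP : IsPoincareConst Ω C_P) (hS : IsSobolevConst Ω C_S) (hm : MemLp m ∞ (vol Ω))
    (hmlw : ∀ᵐ x ∂(vol Ω), m_lw ≤ m x) (u p : H10 Ω) :
    coercivityConst κ₀ m_lw C_P * ‖p‖ * ‖p‖ ≤ residualDeriv κ₀ α hS hm u p p := by
  have h₁ : coercivityConst κ₀ m_lw C_P * ‖p‖ * ‖p‖ ≤ κ₀ * (m_lw * ‖grad p‖ ^ 2) := by
    have := mul_le_mul_of_nonneg_left (hP.min_mul_norm_sq_le p) (by positivity : 0 ≤ κ₀ * m_lw / 2)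
    unfold coercivityConst
    linarith
  have h₂ := mul_le_mul_of_nonneg_left (le_diffusionForm_self hm hmlw p) hκ.le
  have h₃ : 0 ≤ 3 * α * quarticForm hS u u p p :=
    mul_nonneg (by positivity) (quarticForm_self_nonneg hS u p)
  have h₄ : residualDeriv κ₀ α hS hm u p p =
      κ₀ * diffusionForm hm p p + 3 * α * quarticForm hS u u p p := rfl
  linarith

theorem isCoercive_residualDeriv {m_lw C_P : ℝ} (hκ : 0 < κ₀) (hα : 0 < α) (hlw : 0 < m_lw)
    (hP : IsPoincareConst Ω C_P) (hS : IsSobolevConst Ω C_S) (hm : MemLp m ∞ (vol Ω))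
    (hmlw : ∀ᵐ x ∂(vol Ω), m_lw ≤ m x) (u : H10 Ω) :
    IsCoercive (residualDeriv κ₀ α hS hm u) :=
  ⟨_, coercivityConst_pos hκ hlw hP.1, coercivityConst_mul_le hκ hα hlw hP hS hm hmlw u⟩

theorem norm_le_of_residualDeriv_eq {m_lw C_P : ℝ} (hκ : 0 < κ₀) (hα : 0 < α) (hlw : 0 < m_lw)
    (hP : IsPoincareConst Ω C_P) (hS : IsSobolevConst Ω C_S) (hm : MemLp m ∞ (vol Ω))
    (hmlw : ∀ᵐ x ∂(vol Ω), m_lw ≤ m x) {u e z : H10 Ω}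
    (hz : residualDeriv κ₀ α hS hm u z =
      -((3 * α) • quarticForm hS u e e + α • quarticForm hS e e e)) :
    coercivityConst κ₀ m_lw C_P * ‖z‖ ≤
      3 * α * C_S ^ 4 * (‖u‖ * ‖e‖ ^ 2 + ‖e‖ ^ 3) := by
  -- Testing with `z` produces a factor `‖z‖` on both sides, which can be cancelled only when
  -- nonzero.
  rcases eq_or_lt_of_le (norm_nonneg z) with h₀ | h₀
  · rw [← h₀, mul_zero]
    positivity
  refine le_of_mul_le_mul_right ?_ h₀
  have h := coercivityConst_mul_le hκ hα hlw hP hS hm hmlw u z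
  have hz' : residualDeriv κ₀ α hS hm u z z =
      -(3 * α * quarticForm hS u e e z + α * quarticForm hS e e e z) := by
    rw [hz]
    rfl
  have h₁ := mul_le_mul_of_nonneg_left
    ((neg_le_abs _).trans (abs_quarticForm_le hS u e e z)) (by positivity : 0 ≤ 3 * α)
  have h₂ := mul_le_mul_of_nonneg_left
    ((neg_le_abs _).trans (abs_quarticForm_le hS e e e z)) hα.le
  -- The cubic remainder carries only `α`; this term, added twice, enlarges it to the common factor
  -- `3α`.
  have h₃ : 0 ≤ α * (C_S ^ 4 * ‖e‖ * ‖e‖ * ‖e‖ * ‖z‖) := by positivity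
  linarith

end Residual

end NonlinearDiffusion

/-! ### The corrector estimate -/

theorem mainTheorem3 {d : ℕ} (hd₁ : 1 ≤ d) (hd₃ : d ≤ 3)
    (Ω : Set (NonlinearDiffusion.Space d)) (hΩ : IsOpen Ω) (hΩb : Bornology.IsBounded Ω) :
    (∃ C_P : ℝ, NonlinearDiffusion.IsPoincareConst Ω C_P) ∧
    (∃ C_S : ℝ, NonlinearDiffusion.IsSobolevConst Ω C_S) ∧
    ∀ C_P C_S : ℝ, NonlinearDiffusion.IsPoincareConst Ω C_P →
      NonlinearDiffusion.IsSobolevConst Ω C_S →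
    ∀ κ₀ α m_lw : ℝ, 0 < κ₀ → 0 < α → 0 < m_lw →
    ∀ f : NonlinearDiffusion.Space d → ℝ, MemLp f 2 (NonlinearDiffusion.vol Ω) →
    ∀ m ∈ NonlinearDiffusion.Diffusivities Ω m_lw,
    ∀ R : NonlinearDiffusion.H10 Ω → StrongDual ℝ (NonlinearDiffusion.H10 Ω),
      R = NonlinearDiffusion.residualOp κ₀ α f m →
    ∀ C : ℝ, C = 3 * α * C_S ^ 4 / NonlinearDiffusion.coercivityConst κ₀ m_lw C_P →
      (∀ w : NonlinearDiffusion.H10 Ω, NonlinearDiffusion.IsResidual κ₀ α f m w (R w)) ∧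
      (∀ ũ : NonlinearDiffusion.H10 Ω,
        ∃ A : NonlinearDiffusion.H10 Ω ≃L[ℝ] StrongDual ℝ (NonlinearDiffusion.H10 Ω),
          ∀ p : NonlinearDiffusion.H10 Ω, HasLineDerivAt ℝ R (A p) ũ p) ∧
      0 < C ∧
      ∀ u ũ : NonlinearDiffusion.H10 Ω, R u = 0 →
        ‖u - NonlinearDiffusion.corrector R ũ‖ ≤
          C * ‖ũ‖ * ‖u - ũ‖ ^ 2 + C * ‖u - ũ‖ ^ 3 := by
  refine ⟨NonlinearDiffusion.exists_isPoincareConst hd₁ hd₃ hΩb,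
    NonlinearDiffusion.exists_isSobolevConst hd₁ hd₃ hΩb, ?_⟩
  rintro C_P C_S hP hS κ₀ α m_lw hκ hα hlw f hf m ⟨-, hm, hmlw⟩ R rfl C rfl
  have hpos := NonlinearDiffusion.coercivityConst_pos hκ hlw hP.1
  have hder (ũ : NonlinearDiffusion.H10 Ω) :
      ∃ A : NonlinearDiffusion.H10 Ω ≃L[ℝ] StrongDual ℝ (NonlinearDiffusion.H10 Ω),
        (∀ p, A p = NonlinearDiffusion.residualDeriv κ₀ α hS hm ũ p) ∧
        ∀ p, HasLineDerivAt ℝ (NonlinearDiffusion.residualOp κ₀ α f m) (A p) ũ p := by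
    obtain ⟨A, hA⟩ := NonlinearDiffusion.exists_equiv_dual_of_isCoercive
      (NonlinearDiffusion.isCoercive_residualDeriv hκ hα hlw hP hS hm hmlw ũ)
    exact ⟨A, hA, fun p => hA p ▸ NonlinearDiffusion.hasLineDerivAt_residualOp hS hm hf ũ p⟩
  refine ⟨NonlinearDiffusion.isResidual_residualOp hS hm hf,
    fun ũ => (hder ũ).imp fun _ h => h.2, ?_, fun u ũ hu => ?_⟩
  · have := hS.1
    positivity
  obtain ⟨A, hA, hlin⟩ := hder ũ
  -- Expanding about `ũ`, not `u`, makes the linear part the derivative that the corrector inverts,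
  -- and puts `‖ũ‖` in the bound.
  have hexp := NonlinearDiffusion.residualOp_add (κ₀ := κ₀) (α := α) hS hm hf ũ (u - ũ)
  rw [add_sub_cancel, ← hA] at hexp
  have hz := NonlinearDiffusion.apply_sub_corrector hlin hu hexp
  rw [hA] at hz
  have hmain := NonlinearDiffusion.norm_le_of_residualDeriv_eq hκ hα hlw hP hS hm hmlw hz
  rw [mul_comm, ← le_div_iff₀ hpos] at hmain
  refine hmain.trans (le_of_eq ?_)
  ring
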